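/- Define $g:[0,1/8]\to[0,1]$ by $g(0)=0$ and \[g\left(\frac{1}{8}\left(\lfloor z^{-1}\rfloor z^3+\left(1-\lfloor z^{-1}\rfloor z\right)^3\right)\right)=\frac{1}{16}\left(\lfloor z^{-1}\rfloor z^4+\left(1-\lfloor z^{-1}\rfloor z\right)^4\right)\qquad\text{for } z\in(0,1];\] this is well defined, since the argument of $g$ is a strictly increasing function of $z$ that maps $(0,1]$ onto $(0,1/8]$. A real $n\times n$ matrix $A$ is a tournament matrix if all its entries are non-negative and $A+A^T$ is the all-ones matrix. For an $n\times n$ matrix $A$ and $\ell\ge 1$ let $\sigma_\ell(A)=\frac{1}{n^\ell}\operatorname{Tr}A^\ell=\frac{1}{n^\ell}\sum_{i=1}^n\lambda_i^\ell$, where $\lambda_1,\dots,\lambda_n\in\mathbb{C}$ are the eigenvalues of $A$ with multiplicity. Let $A$ be a tournament matrix of order $n$. If $\sigma_3(A)\ge 1/72$, then $\sigma_3(A)\le 1/8$ (so that $g(\sigma_3(A))$ is defined) and $\sigma_4(A)\ge g(\sigma_3(A))$. -/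

import Mathlib

open scoped Matrix

/-- A tournament matrix: a real square matrix with non-negative entries such that `A + Aᵀ` is the
all-ones matrix. -/
def IsTournamentMatrix {n : ℕ} (A : Matrix (Fin n) (Fin n) ℝ) : Prop :=
  (∀ i j, 0 ≤ A i j) ∧ A + Aᵀ = Matrix.of fun _ _ => 1

/-- The normalized power sum of the eigenvalues, `σ_ℓ(A) = Tr (A ^ ℓ) / n ^ ℓ`. -/
noncomputable def tournSigma (l : ℕ) {n : ℕ} (A : Matrix (Fin n) (Fin n) ℝ) : ℝ :=
  (A ^ l).trace / (n : ℝ) ^ l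

/-- The limit density of `C₃` in the blow-up with `⌊z⁻¹⌋` parts of relative size `z` and one
(possibly empty) part with the remaining vertices. -/
noncomputable def blowupC3 (z : ℝ) : ℝ :=
  ((⌊z⁻¹⌋₊ : ℝ) * z ^ 3 + (1 - (⌊z⁻¹⌋₊ : ℝ) * z) ^ 3) / 8

/-- The limit density of `C₄` in the same blow-up. -/
noncomputable def blowupC4 (z : ℝ) : ℝ :=
  ((⌊z⁻¹⌋₊ : ℝ) * z ^ 4 + (1 - (⌊z⁻¹⌋₊ : ℝ) * z) ^ 4) / 16

open Classical in
/-- The function `g` on `[0, 1/8]` with `g 0 = 0` and `g (blowupC3 z) = blowupC4 z` for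
`z ∈ (0, 1]` (see `linialG_zero`, `linialG_blowupC3`; by `exists_blowupC3_eq` this determines `g`
on all of `[0, 1/8]`). Its value outside `[0, 1/8]` is the irrelevant default `0`. -/
noncomputable def linialG (s : ℝ) : ℝ :=
  if h : ∃ z : ℝ, 0 < z ∧ z ≤ 1 ∧ blowupC3 z = s then blowupC4 h.choose else 0

theorem blowupC3_floor {z : ℝ} (hz : 0 < z) (hz1 : z ≤ 1) :
    ∃ k : ℕ, 1 ≤ k ∧ ⌊z⁻¹⌋₊ = k ∧ (k : ℝ) * z ≤ 1 ∧ 1 < ((k : ℝ) + 1) * z := by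
  refine ⟨⌊z⁻¹⌋₊, ?_, rfl, ?_, ?_⟩
  · exact Nat.le_floor (by simpa using (one_le_inv₀ hz).2 hz1)
  · have := Nat.floor_le (inv_pos.2 hz).le
    calc _ ≤ z⁻¹ * z := by gcongr
      _ = 1 := inv_mul_cancel₀ hz.ne'
  · have := Nat.lt_floor_add_one z⁻¹
    calc 1 = z⁻¹ * z := (inv_mul_cancel₀ hz.ne').symm
      _ < _ := by gcongr

theorem blowupC3_piece_lt {k z w : ℝ} (hk : 0 < k) (hz : 1 ≤ (k + 1) * z) (hzw : z < w)
    (hw : k * w ≤ 1) :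
    k * z ^ 3 + (1 - k * z) ^ 3 < k * w ^ 3 + (1 - k * w) ^ 3 := by
  have h0 : 0 < z := by
    by_contra h
    nlinarith
  have e : k * w ^ 3 + (1 - k * w) ^ 3 - (k * z ^ 3 + (1 - k * z) ^ 3)
      = k * (w - z) * ((w ^ 2 - (1 - k * w) ^ 2) + (w * z - (1 - k * w) * (1 - k * z))
        + (z ^ 2 - (1 - k * z) ^ 2)) := by ring
  have hkzw : k * z < k * w := mul_lt_mul_of_pos_left hzw hk
  have h1 : 1 - k * w < w := by nlinarith
  have h2 : 1 - k * z ≤ z := by linarith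
  have a1 : 0 < w ^ 2 - (1 - k * w) ^ 2 := by nlinarith
  have a2 : 0 ≤ z ^ 2 - (1 - k * z) ^ 2 := by nlinarith
  have a3 : 0 ≤ w * z - (1 - k * w) * (1 - k * z) :=
    sub_nonneg.2 (mul_le_mul h1.le h2 (by linarith) (by linarith))
  have : 0 < k * (w - z) * ((w ^ 2 - (1 - k * w) ^ 2) + (w * z - (1 - k * w) * (1 - k * z))
        + (z ^ 2 - (1 - k * z) ^ 2)) :=
    mul_pos (mul_pos hk (by linarith)) (by linarith)
  linarith

theorem blowupC3_lt {z w : ℝ} (hz : 0 < z) (hzw : z < w) (hw : w ≤ 1) :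
    blowupC3 z < blowupC3 w := by
  obtain ⟨k, hk, ek, hk1, hk2⟩ := blowupC3_floor hz (hzw.le.trans hw)
  obtain ⟨m, hm, em, hm1, hm2⟩ := blowupC3_floor (hz.trans hzw) hw
  unfold blowupC3
  rw [ek, em]
  have hk0 : (0 : ℝ) < k := by exact_mod_cast hk
  have hm0 : (0 : ℝ) < m := by exact_mod_cast hm
  have hmk : m ≤ k := by
    by_contra h
    have : (k : ℝ) + 1 ≤ m := by exact_mod_cast not_le.1 h
    nlinarith
  rcases hmk.eq_or_lt with rfl | h
  · have := blowupC3_piece_lt hm0 hk2.le hzw hm1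
    linarith
  · have h' : (m : ℝ) + 1 ≤ k := by exact_mod_cast h
    have A : (k : ℝ) * z ^ 3 + (1 - k * z) ^ 3 ≤ (1 / k) ^ 2 := by
      have e : (k : ℝ) * (1 / k) = 1 := by field_simp
      have e2 : (1 / k : ℝ) ^ 2 = k * (1 / k) ^ 3 + (1 - k * (1 / k)) ^ 3 := by field_simp; ring
      rcases (show z ≤ 1 / k by rw [le_div_iff₀ hk0]; linarith).eq_or_lt with rfl | hlt
      · exact e2.ge
      · exact e2 ▸ (blowupC3_piece_lt hk0 hk2.le hlt e.le).le
    have B : (1 / (m + 1) : ℝ) ^ 2 < m * w ^ 3 + (1 - m * w) ^ 3 := by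
      have e2 : (1 / (m + 1) : ℝ) ^ 2
          = m * (1 / (m + 1)) ^ 3 + (1 - m * (1 / (m + 1))) ^ 3 := by field_simp; ring
      rw [e2]
      refine blowupC3_piece_lt hm0 (by field_simp; rfl) ?_ hm1
      rw [div_lt_iff₀ (by linarith)]
      linarith
    have C : (1 / k : ℝ) ^ 2 ≤ (1 / (m + 1)) ^ 2 := by gcongr
    linarith

theorem exists_blowupC3_eq {s : ℝ} (hs : 0 < s) (hs8 : s ≤ 1 / 8) :
    ∃ z : ℝ, 0 < z ∧ z ≤ 1 ∧ blowupC3 z = s := by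
  have hex : ∃ m : ℕ, (1 / ((m : ℝ) + 1)) ^ 2 < 8 * s := by
    obtain ⟨m, hm⟩ := exists_nat_one_div_lt (show (0 : ℝ) < 8 * s by linarith)
    refine ⟨m, lt_of_le_of_lt ?_ hm⟩
    have h0 : (0 : ℝ) ≤ 1 / ((m : ℝ) + 1) := by positivity
    have h1 : 1 / ((m : ℝ) + 1) ≤ 1 := by
      rw [div_le_one (by positivity)]
      linarith [(Nat.cast_nonneg m : (0 : ℝ) ≤ m)]
    nlinarith
  classical
  obtain ⟨k, hk, hmin⟩ : ∃ k : ℕ, (1 / ((k : ℝ) + 1)) ^ 2 < 8 * s ∧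
      ∀ m < k, ¬ (1 / ((m : ℝ) + 1)) ^ 2 < 8 * s :=
    ⟨Nat.find hex, Nat.find_spec hex, fun m hm => Nat.find_min hex hm⟩
  have hk1 : 1 ≤ k := by
    by_contra h
    obtain rfl : k = 0 := by omega
    norm_num at hk
    linarith
  have hk0 : (0 : ℝ) < k := by exact_mod_cast hk1
  have hup : 8 * s ≤ (1 / (k : ℝ)) ^ 2 := by
    have := not_lt.1 (hmin (k - 1) (by omega))
    rwa [Nat.cast_sub hk1, Nat.cast_one, sub_add_cancel] at this
  have hle : 1 / ((k : ℝ) + 1) ≤ 1 / k := by gcongr; linarith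
  have e1 : (k : ℝ) * (1 / (k + 1)) ^ 3 + (1 - k * (1 / (k + 1))) ^ 3
      = (1 / ((k : ℝ) + 1)) ^ 2 := by field_simp; ring
  have e2 : (k : ℝ) * (1 / k) ^ 3 + (1 - k * (1 / k)) ^ 3 = (1 / (k : ℝ)) ^ 2 := by
    field_simp; ring
  have hc : ContinuousOn (fun z : ℝ => (k : ℝ) * z ^ 3 + (1 - k * z) ^ 3)
      (Set.Icc (1 / ((k : ℝ) + 1)) (1 / k)) := by fun_prop
  obtain ⟨z, ⟨hz1, hz2⟩, hz⟩ := intermediate_value_Icc hle hc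
    (show 8 * s ∈ _ from ⟨by simp only [e1]; exact hk.le, by simp only [e2]; exact hup⟩)
  simp only at hz
  have hne : 1 / ((k : ℝ) + 1) ≠ z := by
    rintro rfl
    linarith
  have hlt := lt_of_le_of_ne hz1 hne
  have hzpos : 0 < z := lt_trans (by positivity) hlt
  have hkz : (k : ℝ) * z ≤ 1 := by
    rw [le_div_iff₀ hk0] at hz2
    linarith
  have hkz' : 1 < ((k : ℝ) + 1) * z := by
    rw [div_lt_iff₀ (by positivity)] at hlt
    linarith
  have hfl : ⌊z⁻¹⌋₊ = k := by
    rw [Nat.floor_eq_iff (by positivity), ← one_div, le_div_iff₀ hzpos, div_lt_iff₀ hzpos]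
    exact ⟨hkz, hkz'⟩
  refine ⟨z, hzpos, ?_, ?_⟩
  · have : (1 : ℝ) ≤ k := by exact_mod_cast hk1
    nlinarith
  · unfold blowupC3
    rw [hfl, hz]
    ring

theorem linialG_blowupC3 {z : ℝ} (hz : 0 < z) (hz1 : z ≤ 1) :
    linialG (blowupC3 z) = blowupC4 z := by
  have h : ∃ w : ℝ, 0 < w ∧ w ≤ 1 ∧ blowupC3 w = blowupC3 z := ⟨z, hz, hz1, rfl⟩
  rw [linialG, dif_pos h]
  obtain ⟨h1, h2, h3⟩ := h.choose_spec
  congr 1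
  rcases lt_trichotomy h.choose z with hlt | heq | hgt
  · exact absurd h3 (blowupC3_lt h1 hlt hz1).ne
  · exact heq
  · exact absurd h3 (blowupC3_lt hz hgt h2).ne'

theorem linialG_zero : linialG 0 = 0 := by
  rw [linialG, dif_neg]
  rintro ⟨z, hz, hz1, h⟩
  obtain ⟨k, hk, ek, hk1, -⟩ := blowupC3_floor hz hz1
  have hk0 : (0 : ℝ) < k := by exact_mod_cast hk
  have a : 0 < (k : ℝ) * z ^ 3 := by positivity
  have b : 0 ≤ (1 - (k : ℝ) * z) ^ 3 := pow_nonneg (by linarith) 3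
  unfold blowupC3 at h
  rw [ek] at h
  linarith

/-! Scale the eigenvalues of `A` by 2/n. The resulting multiset M is closed under conjugation and
has sum 1. Its real parts are non-negative, because A + Aᵀ is positive semidefinite. It contains its
own spectral radius ρ, because all traces of powers are non-negative. Write p_k for the power sums
and e_k for the elementary symmetric functions of M. Newton's identities give p₄ = e₁⁴ - 4e₁D + 2H,
where D = e₁e₂ - e₃ and H = e₂² - 2e₄. Since p₁ and p₃ fix D, it remains to bound H from below. The
key tool is `hurwitz_inequality`, D² ≤ e₁²H in the closed right half-plane, applied to M without ρ.
With q = 1 - ρ it gives qE ≤ q√H(M) as soon as (E + ρ²)q ≤ D(M), where E is the value of e₂ at the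
part sizes of the blow-up with the same p₃. With at most three parts, D(M) - (E + ρ²)(1 - ρ) is the
monic cubic with these sizes (padded by 0) as roots, evaluated at ρ. It is non-negative once ρ is at
least the largest size z, and z ≤ ρ holds because p₃ is at most the cube sum of the blow-up with
parameter ρ. -/

/-! ### Eigenvalues: traces of powers, conjugation, real parts -/

open Polynomial in
/-- The determinant of `p(B)` is the product of the values of `p` at the eigenvalues of `B`. -/
theorem Matrix.det_aeval_eq_prod_roots_charpoly {n K : Type*} [Fintype n] [DecidableEq n] [Field K]
    [IsAlgClosed K] (B : Matrix n n K) (p : K[X]) :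
    (aeval B p).det = (B.charpoly.roots.map fun a => p.eval a).prod := by
  have hs : B.charpoly.Splits := IsAlgClosed.splits _
  have hcard : B.charpoly.roots.card = Fintype.card n := by
    rw [← hs.natDegree_eq_card_roots, B.charpoly_natDegree_eq_dim]
  have hlin : ∀ b : K, (aeval B (X - C b)).det
      = (B.charpoly.roots.map fun a => (X - C b : K[X]).eval a).prod := by
    intro b
    have e : aeval B (X - C b) = -(Matrix.scalar n b - B) := by
      rw [neg_sub, map_sub, aeval_X, aeval_C]
      rfl
    rw [e, Matrix.det_neg, ← Matrix.eval_charpoly,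
      hs.eval_eq_prod_roots_of_monic B.charpoly_monic, ← hcard, ← Multiset.card_map (fun a => b - a),
      ← Multiset.prod_map_neg, Multiset.map_map]
    simp
  rw [(IsAlgClosed.splits p).eq_prod_roots, map_mul, Matrix.det_mul, aeval_C,
    Matrix.algebraMap_eq_diagonal, Matrix.det_diagonal]
  simp only [eval_mul, Multiset.prod_map_mul, eval_C, Multiset.map_const', Multiset.prod_replicate,
    hcard]
  congr 1
  · simp
  · induction p.roots using Multiset.induction with
    | empty => simp
    | cons b s ih =>
      rw [Multiset.map_cons, Multiset.prod_cons, map_mul, Matrix.det_mul, ih, hlin]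
      simp only [eval_mul, Multiset.prod_map_mul]

open Polynomial in
/-- The trace of a power is the corresponding power sum of the eigenvalues. -/
theorem Matrix.trace_pow_eq_sum_roots_charpoly {n K : Type*} [Fintype n] [DecidableEq n] [Field K]
    [IsAlgClosed K] (B : Matrix n n K) (l : ℕ) :
    (B ^ l).trace = (B.charpoly.roots.map fun a => a ^ l).sum := by
  have : Infinite K := IsAlgClosed.instInfinite
  -- Evaluate both sides at c, using the determinant formula for the polynomial c - X^l.
  have h : (B ^ l).charpoly = ((B.charpoly.roots.map fun a => a ^ l).map fun a => X - C a).prod := by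
    refine Polynomial.funext fun c => ?_
    have e : Matrix.scalar n c - B ^ l = aeval B (C c - X ^ l) := by
      rw [map_sub, aeval_C, map_pow, aeval_X]
      rfl
    rw [Matrix.eval_charpoly, e, Matrix.det_aeval_eq_prod_roots_charpoly, eval_multiset_prod,
      Multiset.map_map, Multiset.map_map]
    simp
  rw [Matrix.trace_eq_sum_roots_charpoly, h, roots_multiset_prod_X_sub_C]

open Polynomial ComplexConjugate in
theorem Polynomial.map_conj_roots_map_ofReal (p : ℝ[X]) :
    (p.map (algebraMap ℝ ℂ)).roots.map conj = (p.map (algebraMap ℝ ℂ)).roots := by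
  have h := (IsAlgClosed.splits (p.map (algebraMap ℝ ℂ))).roots_map_of_injective
    (i := starRingEnd ℂ) (RingHom.injective _)
  rw [← h, Polynomial.map_map]
  congr 2
  ext x
  simp

open scoped ComplexOrder in
/-- If the symmetric part of `A` is positive semidefinite, then all eigenvalues of `A` have
non-negative real part. -/
theorem Matrix.re_nonneg_of_mem_roots_charpoly {n : Type*} [Fintype n] [DecidableEq n]
    {A : Matrix n n ℝ} (hA : ((A + Aᵀ).map (algebraMap ℝ ℂ)).PosSemidef) {a : ℂ}
    (ha : a ∈ (A.map (algebraMap ℝ ℂ)).charpoly.roots) : 0 ≤ a.re := by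
  set B := A.map (algebraMap ℝ ℂ) with hB
  have hdet : (Matrix.scalar n a - B).det = 0 := by
    rw [← Matrix.eval_charpoly]
    exact (Polynomial.mem_roots'.1 ha).2
  obtain ⟨v, hv0, hv⟩ := Matrix.exists_mulVec_eq_zero_iff.2 hdet
  have hBv : B *ᵥ v = a • v := by
    rw [Matrix.sub_mulVec, sub_eq_zero] at hv
    rw [← hv]
    ext i
    simp [Matrix.scalar_apply, Matrix.mulVec_diagonal]
  have hsum : (A + Aᵀ).map (algebraMap ℝ ℂ) = B + Bᴴ := by
    ext i j
    simp [hB, Matrix.conjTranspose_apply]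
  -- For an eigenvector v, v*(B + Bᴴ)v = 2 Re(a) v*v.
  have hpos := hA.dotProduct_mulVec_nonneg v
  have hvB : star v ⬝ᵥ (Bᴴ *ᵥ v) = star a * (star v ⬝ᵥ v) := by
    rw [Matrix.dotProduct_mulVec, ← Matrix.star_mulVec, hBv]
    simp
  rw [hsum, Matrix.add_mulVec, dotProduct_add, hvB, hBv, dotProduct_smul, smul_eq_mul,
    ← add_mul] at hpos
  have hvv : 0 < star v ⬝ᵥ v := Matrix.dotProduct_star_self_pos_iff.2 hv0
  obtain ⟨h1, h2⟩ := Complex.lt_def.1 hvv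
  have h3 := (Complex.le_def.1 hpos).1
  rw [Complex.mul_re, ← h2] at h3
  simp only [Complex.zero_re, Complex.zero_im, mul_zero, sub_zero] at h1 h3
  have h4 := nonneg_of_mul_nonneg_left h3 h1
  simp at h4
  linarith

/-! ### The spectral radius as an eigenvalue -/

theorem norm_geom_sum_le {ν : ℂ} (hν : ‖ν‖ ≤ 1) (h1 : ν ≠ 1) (N : ℕ) :
    ‖∑ l ∈ Finset.range N, ν ^ l‖ ≤ 2 / ‖1 - ν‖ := by
  have h : 0 < ‖1 - ν‖ := norm_pos_iff.2 (sub_ne_zero.2 h1.symm)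
  rw [le_div_iff₀ h, ← norm_mul, geom_sum_mul_neg]
  calc ‖1 - ν ^ N‖ ≤ ‖(1 : ℂ)‖ + ‖ν ^ N‖ := norm_sub_le _ _
    _ ≤ 1 + 1 := by
      rw [norm_one, norm_pow]
      gcongr
      exact pow_le_one₀ (norm_nonneg _) hν
    _ = 2 := by norm_num

theorem neg_le_re_geom_sum {ν : ℂ} (hν : ‖ν‖ ≤ 1) (N : ℕ) :
    -(2 / ‖1 - ν‖) ≤ (∑ l ∈ Finset.range N, ν ^ l).re := by
  -- At ν = 1 the bound reads 0 ≤ N, since 2 / 0 = 0.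
  by_cases h1 : ν = 1
  · subst h1
    simp
  · exact (neg_le_neg (norm_geom_sum_le hν h1 N)).trans
      (abs_le.1 (Complex.abs_re_le_norm _)).1

/-- A finite multiset of complex numbers all of whose power sums are non-negative reals contains
its spectral radius. -/
theorem norm_mem_of_powerSums_nonneg {M : Multiset ℂ} {p : ℕ → ℝ} (hp : ∀ l, 0 ≤ p l)
    (hM : ∀ l, (M.map fun μ => μ ^ l).sum = (p l : ℂ)) {a : ℂ} (ha : a ∈ M) (ha0 : a ≠ 0)
    (hmax : ∀ μ ∈ M, ‖μ‖ ≤ ‖a‖) : (‖a‖ : ℂ) ∈ M := by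
  by_contra hmem
  have hr : 0 < ‖a‖ := norm_pos_iff.2 ha0
  have hsum : ∀ (c : ℂ) (N : ℕ), (M.map fun μ => ∑ l ∈ Finset.range N, (μ / c) ^ l).sum
      = ∑ l ∈ Finset.range N, (p l : ℂ) / c ^ l := by
    intro c N
    rw [Multiset.sum_map_sum]
    refine Finset.sum_congr rfl fun l _ => ?_
    simp only [div_pow, ← hM l, Multiset.sum_map_div]
  obtain ⟨M', rfl⟩ := Multiset.exists_cons_of_mem ha
  -- Pringsheim's argument: the sums of p_l / a^l grow at least like N, because a itself contributes
  -- N. They are dominated by the sums of p_l / ‖a‖^l, which stay bounded if ‖a‖ is not in M.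
  set K₁ : ℝ := (M'.map fun μ => 2 / ‖1 - μ / a‖).sum
  set K₂ : ℝ := ((a ::ₘ M').map fun μ => 2 / ‖1 - μ / (‖a‖ : ℂ)‖).sum
  obtain ⟨N, hN⟩ := exists_nat_gt (K₁ + K₂)
  have hlow : (N : ℝ) - K₁
      ≤ (((a ::ₘ M').map fun μ => ∑ l ∈ Finset.range N, (μ / a) ^ l).sum).re := by
    have h : -K₁ ≤ ((M'.map fun μ => ∑ l ∈ Finset.range N, (μ / a) ^ l).sum).re := by
      rw [← Complex.coe_reAddGroupHom, map_multiset_sum, Multiset.map_map,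
        ← Multiset.sum_map_neg', Multiset.map_map]
      refine Multiset.sum_map_le_sum_map _ _ fun μ hμ => neg_le_re_geom_sum (ν := μ / a) ?_ N
      rw [norm_div]
      exact div_le_one_of_le₀ (hmax μ (Multiset.mem_cons_of_mem hμ)) hr.le
    rw [Multiset.map_cons, Multiset.sum_cons, Complex.add_re, div_self ha0]
    simpa [sub_eq_add_neg] using h
  have hup : ‖((a ::ₘ M').map fun μ => ∑ l ∈ Finset.range N, (μ / (‖a‖ : ℂ)) ^ l).sum‖ ≤ K₂ := by
    refine (norm_multiset_sum_le _).trans ?_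
    rw [Multiset.map_map]
    refine Multiset.sum_map_le_sum_map _ _ fun μ hμ => norm_geom_sum_le ?_ ?_ N
    · rw [norm_div, Complex.norm_real, norm_norm]
      exact div_le_one_of_le₀ (hmax μ hμ) hr.le
    · intro h
      rw [div_eq_one_iff_eq (by exact_mod_cast hr.ne')] at h
      exact hmem (h ▸ hμ)
  rw [hsum] at hlow hup
  have h1 : ‖∑ l ∈ Finset.range N, (p l : ℂ) / a ^ l‖
      ≤ ‖∑ l ∈ Finset.range N, (p l : ℂ) / (‖a‖ : ℂ) ^ l‖ := by
    have e : ∑ l ∈ Finset.range N, (p l : ℂ) / (‖a‖ : ℂ) ^ l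
        = ((∑ l ∈ Finset.range N, p l / ‖a‖ ^ l : ℝ) : ℂ) := by push_cast; rfl
    rw [e, Complex.norm_real, Real.norm_of_nonneg (Finset.sum_nonneg fun l _ => div_nonneg (hp l) (by positivity))]
    refine (norm_sum_le _ _).trans (Finset.sum_le_sum fun l _ => ?_)
    rw [norm_div, norm_pow, Complex.norm_real, Real.norm_of_nonneg (hp l)]
  linarith [Complex.re_le_norm (∑ l ∈ Finset.range N, (p l : ℂ) / a ^ l)]

/-! ### A Hurwitz-type inequality for power sums -/

open ComplexConjugate in
/-- Induction principle for multisets of complex numbers that are closed under conjugation. -/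
theorem Multiset.conj_induction {P : Multiset ℂ → Prop} (zero : P 0)
    (real : ∀ (M : Multiset ℂ) (r : ℝ), P M → P ((r : ℂ) ::ₘ M))
    (pair : ∀ (M : Multiset ℂ) (μ : ℂ), P M → P (μ ::ₘ conj μ ::ₘ M))
    (M : Multiset ℂ) (hM : M.map conj = M) : P M := by
  induction h : M.card using Nat.strong_induction_on generalizing M with
  | _ m ih =>
    subst h
    rcases M.empty_or_exists_mem with rfl | ⟨μ, hμ⟩
    · exact zero
    obtain ⟨M', rfl⟩ := Multiset.exists_cons_of_mem hμ
    rw [Multiset.map_cons] at hM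
    by_cases hreal : conj μ = μ
    · rw [hreal, Multiset.cons_inj_right] at hM
      obtain ⟨r, rfl⟩ := Complex.conj_eq_iff_real.1 hreal
      exact real _ _ (ih M'.card (by simp) M' hM rfl)
    · have hc : conj μ ∈ μ ::ₘ M' := by
        rw [← hM]
        exact Multiset.mem_cons_self _ _
      obtain ⟨M'', rfl⟩ := Multiset.exists_cons_of_mem
        ((Multiset.mem_cons.1 hc).resolve_left hreal)
      rw [Multiset.map_cons, Complex.conj_conj, Multiset.cons_swap, Multiset.cons_inj_right,
        Multiset.cons_inj_right] at hM
      exact pair _ _ (ih M''.card (by simp) M'' hM rfl)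

/-- The real part of the `k`-th power sum. -/
noncomputable def rePowerSum (k : ℕ) (M : Multiset ℂ) : ℝ := (M.map fun μ => (μ ^ k).re).sum

@[simp] theorem rePowerSum_zero (k : ℕ) : rePowerSum k 0 = 0 := by simp [rePowerSum]

@[simp] theorem rePowerSum_cons (k : ℕ) (μ : ℂ) (M : Multiset ℂ) :
    rePowerSum k (μ ::ₘ M) = (μ ^ k).re + rePowerSum k M := by simp [rePowerSum]

/-- `e₁ e₂ - e₃` in terms of power sums. -/
noncomputable def hurwitzD (M : Multiset ℂ) : ℝ := (rePowerSum 1 M ^ 3 - rePowerSum 3 M) / 3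

/-- `e₂ ^ 2 - 2 e₄` in terms of power sums (when `e₁ e₂ - e₃` is expressed by `hurwitzD`). -/
noncomputable def hurwitzH (M : Multiset ℂ) : ℝ :=
  (rePowerSum 4 M - rePowerSum 1 M ^ 4 + 4 * rePowerSum 1 M * hurwitzD M) / 2

theorem rePowerSum_four (M : Multiset ℂ) : rePowerSum 4 M
    = rePowerSum 1 M ^ 4 - 4 * rePowerSum 1 M * hurwitzD M + 2 * hurwitzH M := by
  unfold hurwitzH
  ring

theorem hurwitzD_cons_real (M : Multiset ℂ) (r : ℝ) : hurwitzD ((r : ℂ) ::ₘ M)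
    = hurwitzD M + r * rePowerSum 1 M * (rePowerSum 1 M + r) := by
  simp only [hurwitzD, rePowerSum_cons, ← Complex.ofReal_pow, Complex.ofReal_re]
  ring

theorem hurwitzH_cons_real (M : Multiset ℂ) (r : ℝ) : hurwitzH ((r : ℂ) ::ₘ M)
    = hurwitzH M + 2 * r * hurwitzD M + (r * rePowerSum 1 M) ^ 2 := by
  simp only [hurwitzH, hurwitzD, rePowerSum_cons, ← Complex.ofReal_pow, Complex.ofReal_re]
  ring

open ComplexConjugate in
theorem rePowerSum_cons_pair (k : ℕ) (M : Multiset ℂ) (μ : ℂ) :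
    rePowerSum k (μ ::ₘ conj μ ::ₘ M) = 2 * (μ ^ k).re + rePowerSum k M := by
  simp only [rePowerSum_cons, ← map_pow, Complex.conj_re]
  ring

theorem Complex.re_pow_three (μ : ℂ) : (μ ^ 3).re = μ.re ^ 3 - 3 * μ.re * μ.im ^ 2 := by
  simp [pow_succ]
  ring

theorem Complex.re_pow_four (μ : ℂ) :
    (μ ^ 4).re = μ.re ^ 4 - 6 * μ.re ^ 2 * μ.im ^ 2 + μ.im ^ 4 := by
  simp [pow_succ]
  ring

open ComplexConjugate in
theorem hurwitzD_cons_pair (M : Multiset ℂ) (μ : ℂ) : hurwitzD (μ ::ₘ conj μ ::ₘ M)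
    = hurwitzD M + 2 * μ.re * rePowerSum 1 M * (rePowerSum 1 M + 2 * μ.re)
      + 2 * μ.re * (μ.re ^ 2 + μ.im ^ 2) := by
  simp only [hurwitzD, rePowerSum_cons_pair, pow_one, Complex.re_pow_three]
  ring

open ComplexConjugate in
theorem hurwitzH_cons_pair (M : Multiset ℂ) (μ : ℂ) : hurwitzH (μ ::ₘ conj μ ::ₘ M)
    = hurwitzH M + 2 * (2 * μ.re) * hurwitzD M
      + (2 * μ.re * rePowerSum 1 M + (μ.re ^ 2 + μ.im ^ 2)) ^ 2 := by
  simp only [hurwitzH, hurwitzD, rePowerSum_cons_pair, pow_one, Complex.re_pow_three,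
    Complex.re_pow_four]
  ring

/-- One step of the induction for `hurwitz_inequality`: the effect of a factor `1 + X s + P s ^ 2`
on the triple `(e₁, e₁ e₂ - e₃, e₂ ^ 2 - 2 e₄)`. -/
theorem hurwitz_step {e D H X P : ℝ} (he : 0 ≤ e) (hD : 0 ≤ D) (hH : 0 ≤ H)
    (h : D ^ 2 ≤ e ^ 2 * H) (hX : 0 ≤ X) (hP : 0 ≤ P) :
    (D + X * e * (e + X) + X * P) ^ 2 ≤ (e + X) ^ 2 * (H + 2 * X * D + (X * e + P) ^ 2) := by
  -- As a quadratic in P this has discriminant D² - 4e²H ≤ 0.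
  have key : 0 ≤ e * P ^ 2 - P * D + e * H := by
    rcases he.eq_or_lt with rfl | he
    · have : D = 0 := by nlinarith
      simp [this]
    · refine nonneg_of_mul_nonneg_right (a := e) ?_ he
      nlinarith [sq_nonneg (e * P - D / 2)]
  have e1 : (e + X) ^ 2 * (H + 2 * X * D + (X * e + P) ^ 2)
      - (D + X * e * (e + X) + X * P) ^ 2
      = (e ^ 2 * H - D ^ 2) + 2 * X * (e * P ^ 2 - P * D + e * H) + X ^ 2 * (H + 2 * e * D)
        + 2 * X ^ 3 * D + e ^ 2 * P ^ 2 + 2 * X * P * e ^ 3 + 2 * e ^ 2 * X ^ 2 * P := by ring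
  have : 0 ≤ e ^ 2 * H - D ^ 2 := sub_nonneg.2 h
  have : 0 ≤ (e ^ 2 * H - D ^ 2) + 2 * X * (e * P ^ 2 - P * D + e * H) + X ^ 2 * (H + 2 * e * D)
        + 2 * X ^ 3 * D + e ^ 2 * P ^ 2 + 2 * X * P * e ^ 3 + 2 * e ^ 2 * X ^ 2 * P := by positivity
  linarith

open ComplexConjugate in
/-- A Hurwitz-type inequality between the power sums of a conjugation-closed multiset in the closed
right half-plane. -/
theorem hurwitz_inequality (M : Multiset ℂ) (hM : M.map conj = M) (hre : ∀ μ ∈ M, 0 ≤ μ.re) :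
    0 ≤ rePowerSum 1 M ∧ 0 ≤ hurwitzD M ∧ 0 ≤ hurwitzH M ∧
      hurwitzD M ^ 2 ≤ rePowerSum 1 M ^ 2 * hurwitzH M := by
  revert hre
  refine Multiset.conj_induction (P := fun M => (∀ μ ∈ M, 0 ≤ μ.re) → 0 ≤ rePowerSum 1 M ∧
    0 ≤ hurwitzD M ∧ 0 ≤ hurwitzH M ∧ hurwitzD M ^ 2 ≤ rePowerSum 1 M ^ 2 * hurwitzH M) ?_ ?_ ?_ M hM
  · simp [hurwitzH, hurwitzD]
  · intro M r ih hre
    obtain ⟨he, hD, hH, h⟩ := ih fun μ hμ => hre μ (Multiset.mem_cons_of_mem hμ)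
    have hr : 0 ≤ r := by simpa using hre r (Multiset.mem_cons_self _ _)
    rw [hurwitzD_cons_real, hurwitzH_cons_real, rePowerSum_cons, pow_one, Complex.ofReal_re]
    refine ⟨by positivity, by positivity, by positivity, ?_⟩
    have := hurwitz_step he hD hH h hr le_rfl
    simpa [add_comm] using this
  · intro M μ ih hre
    obtain ⟨he, hD, hH, h⟩ := ih fun ν hν =>
      hre ν (Multiset.mem_cons_of_mem (Multiset.mem_cons_of_mem hν))
    have hx : 0 ≤ μ.re := hre μ (Multiset.mem_cons_self _ _)
    rw [hurwitzD_cons_pair, hurwitzH_cons_pair, rePowerSum_cons_pair, pow_one]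
    refine ⟨by positivity, by positivity, by positivity, ?_⟩
    have := hurwitz_step he hD hH h (mul_nonneg zero_le_two hx)
      (show 0 ≤ μ.re ^ 2 + μ.im ^ 2 by positivity)
    rwa [add_comm (2 * μ.re) (rePowerSum 1 M)]

/-! ### Comparison with the blow-up -/

/-- Among multisets in `[0, ρ]` with given sum, the sum of cubes is maximal when all but one of the
non-zero elements are `ρ`. -/
theorem sum_cube_le_of_mem_Icc {ρ : ℝ} (hρ : 0 < ρ) (M : Multiset ℝ) (hM : ∀ x ∈ M, 0 ≤ x ∧ x ≤ ρ) :
    ∃ (k : ℕ) (f : ℝ), 0 ≤ f ∧ f < ρ ∧ M.sum = k * ρ + f ∧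
      (M.map fun x => x ^ 3).sum ≤ k * ρ ^ 3 + f ^ 3 := by
  induction M using Multiset.induction with
  | empty => exact ⟨0, 0, by simpa using hρ⟩
  | cons x M ih =>
    obtain ⟨k, f, hf, hfρ, hs, hc⟩ := ih fun y hy => hM y (Multiset.mem_cons_of_mem hy)
    obtain ⟨hx, hxρ⟩ := hM x (Multiset.mem_cons_self _ _)
    rw [Multiset.map_cons, Multiset.sum_cons, Multiset.sum_cons, hs]
    -- Merge x with the remainder f; on overflow, split off a full ρ. The cube sum then grows by 3(ρ
    -- - f)(ρ - x)(f + x).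
    rcases lt_or_ge (f + x) ρ with h | h
    · refine ⟨k, f + x, by positivity, h, by ring, ?_⟩
      have : 0 ≤ f * x * (f + x) := by positivity
      nlinarith
    · refine ⟨k + 1, f + x - ρ, by linarith, by linarith, by push_cast; ring, ?_⟩
      have : 0 ≤ (ρ - f) * (ρ - x) * (f + x) :=
        mul_nonneg (mul_nonneg (by linarith) (by linarith)) (by linarith)
      push_cast
      nlinarith

theorem sum_cube_le_blowupC3 {ρ : ℝ} (hρ : 0 < ρ) (M : Multiset ℝ)
    (hM : ∀ x ∈ M, 0 ≤ x ∧ x ≤ ρ) (h1 : M.sum = 1) :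
    (M.map fun x => x ^ 3).sum ≤ 8 * blowupC3 ρ := by
  obtain ⟨k, f, hf, hfρ, hs, hc⟩ := sum_cube_le_of_mem_Icc hρ M hM
  have hk : ⌊ρ⁻¹⌋₊ = k := by
    rw [Nat.floor_eq_iff (by positivity), ← one_div, le_div_iff₀ hρ, div_lt_iff₀ hρ]
    constructor <;> linarith
  have hf' : f = 1 - k * ρ := by linarith
  rw [blowupC3, hk, ← hf']
  linarith

/-- For `1 / 3 ≤ z ≤ 1` the blow-up has at most three parts; `τ = e₂ - e₃` and `E = e₂` are
symmetric functions of their sizes. -/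
theorem blowup_symmetric {z : ℝ} (hz : 1 / 3 ≤ z) (hz1 : z ≤ 1) :
    ∃ τ E : ℝ, 8 * blowupC3 z = 1 - 3 * τ ∧ 16 * blowupC4 z = 1 - 4 * τ + 2 * E ^ 2 ∧
      0 ≤ E ∧ E ≤ 3 * τ ∧ ∀ ρ, z ≤ ρ → ρ ≤ 1 → (E + ρ ^ 2) * (1 - ρ) ≤ τ := by
  have h0 : 0 < z := by linarith
  obtain ⟨k, hk, ek, hk1, hk2⟩ := blowupC3_floor h0 hz1
  have hk3 : k ≤ 3 := by
    by_contra h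
    have : (4 : ℝ) ≤ k := by exact_mod_cast not_le.1 h
    nlinarith
  have two : ∀ m : ℕ, ⌊z⁻¹⌋₊ = m → m = 1 → 1 / 2 < z → ∃ τ E : ℝ, 8 * blowupC3 z = 1 - 3 * τ ∧
      16 * blowupC4 z = 1 - 4 * τ + 2 * E ^ 2 ∧
      0 ≤ E ∧ E ≤ 3 * τ ∧ ∀ ρ, z ≤ ρ → ρ ≤ 1 → (E + ρ ^ 2) * (1 - ρ) ≤ τ := by
    rintro m hm rfl hz2
    have hp : 0 ≤ z * (1 - z) := mul_nonneg h0.le (by linarith)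
    refine ⟨z * (1 - z), z * (1 - z), ?_, ?_, hp, by linarith, fun ρ h1 h2 => ?_⟩
    · rw [blowupC3, hm]
      push_cast
      ring
    · rw [blowupC4, hm]
      push_cast
      ring
    -- The cubic with roots 0, z, 1 - z, evaluated at ρ.
    · have : 0 ≤ ρ * ((ρ - z) * (ρ + z - 1)) :=
        mul_nonneg (by linarith) (mul_nonneg (by linarith) (by linarith))
      nlinarith
  have three : ∀ c3 c4 : ℝ, c3 = 2 * z ^ 3 + (1 - 2 * z) ^ 3 → c4 = 2 * z ^ 4 + (1 - 2 * z) ^ 4 →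
      z ≤ 1 / 2 → ∃ τ E : ℝ, c3 = 1 - 3 * τ ∧ c4 = 1 - 4 * τ + 2 * E ^ 2 ∧
      0 ≤ E ∧ E ≤ 3 * τ ∧ ∀ ρ, z ≤ ρ → ρ ≤ 1 → (E + ρ ^ 2) * (1 - ρ) ≤ τ := by
    rintro _ _ rfl rfl hz2
    refine ⟨2 * z * (1 - z) ^ 2, 2 * z - 3 * z ^ 2, by ring, by ring, by nlinarith, ?_,
      fun ρ h1 h2 => ?_⟩
    · nlinarith [mul_nonneg h0.le (sq_nonneg (z - 3 / 4))]
    -- The cubic with roots z, z, 1 - 2z, evaluated at ρ.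
    · have : 0 ≤ (ρ - z) ^ 2 * (ρ + 2 * z - 1) := mul_nonneg (sq_nonneg _) (by linarith)
      nlinarith
  interval_cases k
  · exact two 1 ek rfl (by norm_num at hk2; linarith)
  · refine three _ _ ?_ ?_ (by norm_num at hk1; linarith)
    · rw [blowupC3, ek]
      push_cast
      ring
    · rw [blowupC4, ek]
      push_cast
      ring
  · obtain rfl : z = 1 / 3 := by
      norm_num at hk1
      linarith
    refine three _ _ ?_ ?_ (by norm_num)
    · rw [blowupC3, ek]
      norm_num
    · rw [blowupC4, ek]
      norm_num

/-! ### The inequality for spectra -/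

theorem re_pow_three_le {μ : ℂ} (h : 0 ≤ μ.re) : (μ ^ 3).re ≤ μ.re ^ 3 := by
  rw [Complex.re_pow_three]
  have : 0 ≤ 3 * μ.re * μ.im ^ 2 := by positivity
  linarith

/-- Passing to real parts only increases the cube sum. This is what forces z ≤ ρ in the main
theorem. -/
theorem rePowerSum_three_le {M : Multiset ℂ} {ρ : ℝ} (hρ : 0 < ρ)
    (hM : ∀ μ ∈ M, 0 ≤ μ.re ∧ μ.re ≤ ρ) (h1 : rePowerSum 1 M = 1) :
    rePowerSum 3 M ≤ 8 * blowupC3 ρ := by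
  have h := sum_cube_le_blowupC3 hρ (M.map Complex.re)
    (by simpa only [Multiset.mem_map, forall_exists_index, and_imp, forall_apply_eq_imp_iff₂])
    (by simpa [rePowerSum] using h1)
  rw [Multiset.map_map] at h
  exact (Multiset.sum_map_le_sum_map _ _ fun μ hμ => re_pow_three_le (hM μ hμ).1).trans h

open ComplexConjugate in
/-- The spectral form of the main inequality. -/
theorem blowupC4_le_rePowerSum {M : Multiset ℂ} (hM : M.map conj = M) {ρ : ℝ} (hρ : (ρ : ℂ) ∈ M)
    (hre : ∀ μ ∈ M, 0 ≤ μ.re ∧ μ.re ≤ ρ) (h1 : rePowerSum 1 M = 1) {z : ℝ} (hz : 1 / 3 ≤ z)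
    (hz1 : z ≤ 1) (hzρ : z ≤ ρ) (h3 : rePowerSum 3 M = 8 * blowupC3 z) :
    16 * blowupC4 z ≤ rePowerSum 4 M := by
  obtain ⟨τ, E, e3, e4, hE, hEτ, hτ⟩ := blowup_symmetric hz hz1
  have hD : hurwitzD M = τ := by
    rw [hurwitzD, h1, h3, e3]
    ring
  rw [rePowerSum_four, h1, hD, e4]
  suffices E ^ 2 ≤ hurwitzH M by linarith
  obtain ⟨R, rfl⟩ := Multiset.exists_cons_of_mem hρ
  rw [Multiset.map_cons, Complex.conj_ofReal, Multiset.cons_inj_right] at hM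
  obtain ⟨hq, hD', hH', h⟩ := hurwitz_inequality R hM
    fun μ hμ => (hre μ (Multiset.mem_cons_of_mem hμ)).1
  rw [rePowerSum_cons, pow_one, Complex.ofReal_re] at h1
  rw [hurwitzD_cons_real] at hD
  rw [hurwitzH_cons_real]
  set q := rePowerSum 1 R
  set D := hurwitzD R
  set H := hurwitzH R
  obtain rfl : ρ = 1 - q := by linarith
  -- If q = 0 then ρ = 1 and τ = D = 0, so E ≤ 3τ forces E = 0. Otherwise multiply the goal by q²:
  -- the Hurwitz inequality for R makes q²H(M) at least the square (D + ρq²)².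
  rcases hq.eq_or_lt with hq0 | hq0
  · rw [← hq0] at hD h ⊢
    have : D = 0 := by nlinarith
    have : E = 0 := by linarith
    subst this
    have := mul_nonneg (sub_nonneg.2 zero_le_one : (0 : ℝ) ≤ 1 - 0) hD'
    nlinarith
  · have hb : E * q ≤ D + (1 - q) * q ^ 2 := by
      have := hτ (1 - q) hzρ (by linarith)
      nlinarith
    have hsq : (E * q) ^ 2 ≤ (D + (1 - q) * q ^ 2) ^ 2 := by gcongr
    refine le_of_mul_le_mul_left ?_ (pow_pos hq0 2)
    nlinarith

/-! ### Tournament matrices -/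

theorem IsTournamentMatrix.trace {n : ℕ} {A : Matrix (Fin n) (Fin n) ℝ} (hA : IsTournamentMatrix A) :
    A.trace = n / 2 := by
  have h : ∀ i, A i i = 1 / 2 := by
    intro i
    have := congrFun (congrFun hA.2 i) i
    simp at this
    linarith
  simp [Matrix.trace, h]
  ring

open scoped ComplexOrder in
theorem IsTournamentMatrix.posSemidef {n : ℕ} {A : Matrix (Fin n) (Fin n) ℝ}
    (hA : IsTournamentMatrix A) : ((A + Aᵀ).map (algebraMap ℝ ℂ)).PosSemidef := by
  have : (A + Aᵀ).map (algebraMap ℝ ℂ)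
      = Matrix.vecMulVec (fun _ : Fin n => (1 : ℂ)) (star fun _ : Fin n => (1 : ℂ)) := by
    rw [hA.2]
    ext i j
    simp [Matrix.vecMulVec_apply]
  rw [this]
  exact Matrix.posSemidef_vecMulVec_self_star _

open ComplexConjugate in
/-- The spectrum of a tournament matrix, scaled to have sum `1`. -/
theorem IsTournamentMatrix.exists_spectrum {n : ℕ} (hn : 0 < n) {A : Matrix (Fin n) (Fin n) ℝ}
    (hA : IsTournamentMatrix A) :
    ∃ (M : Multiset ℂ) (ρ : ℝ), M.map conj = M ∧ 0 < ρ ∧ (ρ : ℂ) ∈ M ∧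
      (∀ μ ∈ M, 0 ≤ μ.re ∧ μ.re ≤ ρ) ∧ rePowerSum 1 M = 1 ∧
      ∀ l, rePowerSum l M = 2 ^ l * tournSigma l A := by
  have hn' : (0 : ℝ) < n := by exact_mod_cast hn
  set B := A.map (algebraMap ℝ ℂ) with hB
  set c : ℝ := 2 / n with hc
  have hc0 : 0 < c := by positivity
  set M := B.charpoly.roots.map fun a => (c : ℂ) * a with hMdef
  have hconj : M.map conj = M := by
    have h := Polynomial.map_conj_roots_map_ofReal A.charpoly
    rw [← Matrix.charpoly_map] at h
    rw [hMdef, Multiset.map_map]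
    conv_rhs => rw [hB, ← h, Multiset.map_map]
    refine Multiset.map_congr rfl fun a _ => ?_
    simp
  have hsum : ∀ l, (M.map fun μ => μ ^ l).sum = ((2 ^ l * tournSigma l A : ℝ) : ℂ) := by
    intro l
    have h := B.trace_pow_eq_sum_roots_charpoly l
    have ht : (B ^ l).trace = ((A ^ l).trace : ℂ) := by
      rw [hB, ← RingHom.mapMatrix_apply, ← map_pow]
      simp [Matrix.trace]
    rw [hMdef, Multiset.map_map]
    simp only [Function.comp_def, mul_pow, Multiset.sum_map_mul_left]
    rw [← h, ht, tournSigma, hc]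
    push_cast
    rw [div_pow]
    ring
  have hpow : ∀ l, rePowerSum l M = 2 ^ l * tournSigma l A := by
    intro l
    rw [← Complex.ofReal_re (2 ^ l * _), ← hsum l, ← Complex.coe_reAddGroupHom, map_multiset_sum,
      Multiset.map_map (g := Complex.reAddGroupHom)]
    rfl
  have hone : rePowerSum 1 M = 1 := by
    rw [hpow, tournSigma, pow_one, pow_one, pow_one, hA.trace]
    field_simp
  have hre : ∀ μ ∈ M, 0 ≤ μ.re := by
    intro μ hμ
    obtain ⟨a, ha, rfl⟩ := Multiset.mem_map.1 hμ
    rw [Complex.re_ofReal_mul]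
    exact mul_nonneg hc0.le (Matrix.re_nonneg_of_mem_roots_charpoly hA.posSemidef ha)
  obtain ⟨a, ha, hmax⟩ : ∃ a ∈ M, ∀ μ ∈ M, ‖μ‖ ≤ ‖a‖ := by
    have hne : M ≠ 0 := by
      intro h
      simp [h] at hone
    obtain ⟨a, ha, h⟩ := M.toFinset.exists_max_image norm
      (by rwa [Multiset.toFinset_nonempty])
    exact ⟨a, Multiset.mem_toFinset.1 ha, fun μ hμ => h μ (Multiset.mem_toFinset.2 hμ)⟩
  have ha0 : a ≠ 0 := by
    rintro rfl
    have h0 : ∀ μ ∈ M, (μ ^ 1).re = 0 := by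
      intro μ hμ
      have := hmax μ hμ
      rw [norm_zero, norm_le_zero_iff] at this
      simp [this]
    have : rePowerSum 1 M = 0 := by
      rw [rePowerSum, Multiset.map_congr rfl h0]
      simp
    linarith
  have hnonneg : ∀ l, 0 ≤ 2 ^ l * tournSigma l A := fun l => by
    have : 0 ≤ (A ^ l).trace := Finset.sum_nonneg fun i _ => Matrix.pow_apply_nonneg hA.1 l i i
    unfold tournSigma
    positivity
  exact ⟨M, ‖a‖, hconj, norm_pos_iff.2 ha0, norm_mem_of_powerSums_nonneg hnonneg hsum ha ha0 hmax,
    fun μ hμ => ⟨hre μ hμ, (Complex.re_le_norm μ).trans (hmax μ hμ)⟩, hone, hpow⟩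

theorem theorem4p6 (n : ℕ) (A : Matrix (Fin n) (Fin n) ℝ) (hA : IsTournamentMatrix A)
    (h3 : 1 / 72 ≤ tournSigma 3 A) :
    tournSigma 3 A ≤ 1 / 8 ∧ linialG (tournSigma 3 A) ≤ tournSigma 4 A := by
  have hn : 0 < n := by
    rcases n.eq_zero_or_pos with rfl | h
    · norm_num [tournSigma] at h3
    · exact h
  obtain ⟨M, ρ, hconj, hρ, hmem, hre, h1, hpow⟩ := hA.exists_spectrum hn
  have hρ1 : ρ ≤ 1 := by
    obtain ⟨R, rfl⟩ := Multiset.exists_cons_of_mem hmem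
    rw [rePowerSum_cons, pow_one, Complex.ofReal_re] at h1
    have : 0 ≤ rePowerSum 1 R := by
      refine Multiset.sum_nonneg fun x hx => ?_
      obtain ⟨μ, hμ, rfl⟩ := Multiset.mem_map.1 hx
      simpa using (hre μ (Multiset.mem_cons_of_mem hμ)).1
    linarith
  have hle : tournSigma 3 A ≤ blowupC3 ρ := by
    have := rePowerSum_three_le hρ hre h1
    rw [hpow] at this
    linarith
  have hmono : ∀ {x y : ℝ}, 0 < x → y ≤ 1 → x ≤ y → blowupC3 x ≤ blowupC3 y := by
    intro x y hx hy hxy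
    rcases hxy.eq_or_lt with rfl | h
    · exact le_rfl
    · exact (blowupC3_lt hx h hy).le
  have h8 : tournSigma 3 A ≤ 1 / 8 := by
    refine hle.trans ((hmono hρ le_rfl hρ1).trans ?_)
    norm_num [blowupC3]
  refine ⟨h8, ?_⟩
  obtain ⟨z, hz, hz1, hzs⟩ := exists_blowupC3_eq (by linarith) h8
  rw [← hzs, linialG_blowupC3 hz hz1]
  -- The threshold 1/72 is the value for three equal parts, so the blow-up has at most three
  -- non-empty parts.
  have hz3 : 1 / 3 ≤ z := by
    by_contra h
    have hlt := blowupC3_lt hz (not_le.1 h) (by norm_num)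
    have e : blowupC3 (1 / 3) = 1 / 72 := by
      norm_num [blowupC3]
    linarith
  have hzρ : z ≤ ρ := by
    by_contra h
    have := blowupC3_lt hρ (not_le.1 h) hz1
    linarith
  have h := blowupC4_le_rePowerSum hconj hmem hre h1 hz3 hz1 hzρ (by rw [hpow, hzs]; norm_num)
  rw [hpow] at h
  linarith
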